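/- Let $\alpha>0$ and let $(c_j)_{j\ge 1}$ be any non-negative solution on $[0,\infty)$ of the addition model with constant monomer input $$\dot c_1=\alpha-c_1^2-c_1\sum_{k=1}^{\infty}c_k,\qquad \dot c_j=c_1c_{j-1}-c_1c_j\quad (j\ge 2);$$ that is, every $c_j:[0,\infty)\to[0,\infty)$ is continuous, and for every $t>0$ the series $\sum_{k\ge1}c_k(t)$ converges and the equations hold at $t$. Assume that $\sum_{j=1}^{\infty}c_j(0)<\infty$. Then, as $t\to+\infty$: (i) $\left(\frac{3}{\alpha}t\right)^{1/3}c_j(t)\to 1$ for every $j\ge 1$; (ii) $\left(3\alpha^2t\right)^{-1/3}\sum_{j=1}^{\infty}c_j(t)\to 1$; (iii) $\left(\frac{3}{\alpha}t\right)^{2/3}\left(\alpha-c_1(t)\sum_{j=1}^{\infty}c_j(t)\right)\to 1$. -/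

import Mathlib

open Filter Topology

/-- The total concentration of clusters `∑_{j ≥ 1} c_j(t)`.
The concentrations are indexed by cluster size, and the value `c 0` plays no role. -/
noncomputable def totalClusters (c : ℕ → ℝ → ℝ) (t : ℝ) : ℝ :=
  ∑' j : ℕ, c (j + 1) t

/-- `(c_j)_{j ≥ 1}` is a non-negative solution on `[0, ∞)` of the addition model with constant
coagulation coefficients and constant monomer input `α`:
`c_1' = α - c_1² - c_1 ∑_{j ≥ 1} c_j` and `c_j' = c_1 c_{j-1} - c_1 c_j` for `j ≥ 2`.
Every `c_j` is continuous on `[0, ∞)`; for `t > 0` the series in the system converges and the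
equations hold. -/
structure IsNonnegSolution (α : ℝ) (c : ℕ → ℝ → ℝ) : Prop where
  nonneg : ∀ j : ℕ, 1 ≤ j → ∀ t : ℝ, 0 ≤ t → 0 ≤ c j t
  continuousOn : ∀ j : ℕ, 1 ≤ j → ContinuousOn (c j) (Set.Ici 0)
  summable : ∀ t : ℝ, 0 < t → Summable (fun j : ℕ => c (j + 1) t)
  deriv_one : ∀ t : ℝ, 0 < t →
    HasDerivAt (c 1) (α - c 1 t ^ 2 - c 1 t * totalClusters c t) t
  deriv_of_two_le : ∀ j : ℕ, 2 ≤ j → ∀ t : ℝ, 0 < t →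
    HasDerivAt (c j) (c 1 t * c (j - 1) t - c 1 t * c j t) t

/-! Put `x = c 1` and let `z` be the density of all larger clusters. The gain and loss terms
telescope, so the infinite system closes: `x' = α - 2x² - xz`, `z' = x²`. Then `z → ∞`, which forces
`x → 0` and `xz → α`; hence `(z³)' = 3(xz)² → 3α²`, so `z ~ (3α²t)^(1/3)` and `x ~ α/z`. Nearly
every limit comes from `tendsto_of_relaxation`: write the derivative of the quantity as `A (g - R)`
with `tA ≥ 1` and find the limit of `g`. This also passes from `c j` to `c (j + 1)` and gives the
rate in (iii). -/

/-! ### Scalar comparison and relaxation -/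

theorem eventually_le_of_deriv_le_neg_div {R R' : ℝ → ℝ} {b δ : ℝ} (hδ : 0 < δ)
    (hR : ∀ᶠ t in atTop, HasDerivAt R (R' t) t)
    (h : ∀ᶠ t in atTop, b ≤ R t → R' t ≤ -δ / t) : ∀ᶠ t in atTop, R t ≤ b := by
  obtain ⟨T, hT⟩ := eventually_atTop.1 ((hR.and h).and (eventually_ge_atTop (1 : ℝ)))
  have hT1 : 1 ≤ T := (hT T le_rfl).2
  -- Since `δ / t` has infinite integral, `R` cannot stay above `b`: `R + δ log t` would be
  -- nonincreasing.
  obtain ⟨t₀, ht₀, hlt⟩ : ∃ t₀, T ≤ t₀ ∧ R t₀ ≤ b := by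
    by_contra! hcon
    have hd : ∀ t, T ≤ t → HasDerivAt (fun t => R t + δ * Real.log t) (R' t + δ * t⁻¹) t :=
      fun t ht => (hT t ht).1.1.add
        ((Real.hasDerivAt_log (by linarith)).const_mul δ)
    have hanti : AntitoneOn (fun t => R t + δ * Real.log t) (Set.Ici T) := by
      apply antitoneOn_of_deriv_nonpos (convex_Ici T)
      · exact fun t ht => (hd t ht).continuousAt.continuousWithinAt
      · intro t ht
        rw [interior_Ici] at ht
        exact (hd t (le_of_lt ht)).differentiableAt.differentiableWithinAt
      · intro t ht
        rw [interior_Ici] at ht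
        have ht' : T ≤ t := le_of_lt ht
        rw [(hd t ht').deriv]
        have := (hT t ht').1.2 (hcon t ht').le
        rw [neg_div, div_eq_mul_inv] at this
        linarith
    have hlog : Tendsto (fun t => δ * Real.log t) atTop atTop :=
      Real.tendsto_log_atTop.const_mul_atTop hδ
    obtain ⟨t, hbig, ht⟩ := ((hlog.eventually_gt_atTop (R T + δ * Real.log T - b)).and
      (eventually_ge_atTop T)).exists
    have h1 : R t + δ * Real.log t ≤ R T + δ * Real.log T :=
      hanti Set.self_mem_Ici ht ht
    have h2 := hcon t ht
    linarith
  filter_upwards [eventually_ge_atTop t₀] with t ht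
  -- Once below, `R` cannot recross the level `b`, where its derivative is negative.
  refine image_le_of_deriv_right_lt_deriv_boundary (f := R) (f' := R') (a := t₀) (b := t)
    (B := fun _ => b) (B' := fun _ => 0) ?_ ?_ hlt (fun x => hasDerivAt_const x b) ?_
    (Set.right_mem_Icc.2 ht)
  · exact fun u hu => (hT u (ht₀.trans hu.1)).1.1.continuousAt.continuousWithinAt
  · exact fun u hu => (hT u (ht₀.trans hu.1)).1.1.hasDerivWithinAt
  · intro u hu hub
    have hu0 : 0 < u := by linarith [hu.1]
    have := (hT u (ht₀.trans hu.1)).1.2 hub.ge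
    have h3 : 0 < δ / u := div_pos hδ hu0
    rw [neg_div] at this
    linarith

theorem eventually_le_of_deriv_le_neg {R R' : ℝ → ℝ} {b δ : ℝ} (hδ : 0 < δ)
    (hR : ∀ᶠ t in atTop, HasDerivAt R (R' t) t)
    (h : ∀ᶠ t in atTop, b ≤ R t → R' t ≤ -δ) : ∀ᶠ t in atTop, R t ≤ b := by
  refine eventually_le_of_deriv_le_neg_div hδ hR ?_
  filter_upwards [h, eventually_ge_atTop 1] with t ht h1 hb
  have := ht hb
  have h2 : δ / t ≤ δ := div_le_self hδ.le h1
  rw [neg_div]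
  linarith

theorem eventually_le_of_relaxation {R A g : ℝ → ℝ} {L ε : ℝ} (hε : 0 < ε)
    (hR : ∀ᶠ t in atTop, HasDerivAt R (A t * (g t - R t)) t)
    (hA : ∀ᶠ t in atTop, 1 ≤ t * A t) (hg : Tendsto g atTop (𝓝 L)) :
    ∀ᶠ t in atTop, R t ≤ L + ε := by
  refine eventually_le_of_deriv_le_neg_div (half_pos hε) hR ?_
  filter_upwards [hA, hg.eventually_le_const (show L < L + ε / 2 by linarith),
    eventually_gt_atTop 0] with t hAt hgt ht hb
  rw [le_div_iff₀ ht]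
  have h1 : g t - R t ≤ -(ε / 2) := by linarith
  nlinarith

/-- A quantity relaxing to `g` at rate `A`, with `∫ A = ∞` ensured by `A t ≥ 1 / t`,
has the same limit as `g`. -/
theorem tendsto_of_relaxation {R A g : ℝ → ℝ} {L : ℝ}
    (hR : ∀ᶠ t in atTop, HasDerivAt R (A t * (g t - R t)) t)
    (hA : ∀ᶠ t in atTop, 1 ≤ t * A t) (hg : Tendsto g atTop (𝓝 L)) :
    Tendsto R atTop (𝓝 L) := by
  have hR' : ∀ᶠ t in atTop, HasDerivAt (fun t => -R t) (A t * (-g t - -R t)) t := by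
    filter_upwards [hR] with t ht
    exact ht.neg.congr_deriv (by ring)
  rw [Metric.tendsto_nhds]
  intro ε hε
  filter_upwards [eventually_le_of_relaxation (half_pos hε) hR hA hg,
    eventually_le_of_relaxation (half_pos hε) hR' hA hg.neg] with t h1 h2
  rw [Real.dist_eq, abs_lt]
  constructor <;> linarith

/-- If `u'` tends to `L`, then so does `u t / t`. -/
theorem tendsto_div_id_of_tendsto_deriv {u u' : ℝ → ℝ} {L : ℝ}
    (hu : ∀ᶠ t in atTop, HasDerivAt u (u' t) t) (hL : Tendsto u' atTop (𝓝 L)) :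
    Tendsto (fun t => u t / t) atTop (𝓝 L) := by
  refine tendsto_of_relaxation (A := fun t => 1 / t) ?_ ?_ hL
  · filter_upwards [hu, eventually_gt_atTop 0] with t ht h0
    refine (ht.div (hasDerivAt_id t) h0.ne').congr_deriv ?_
    simp only [id]
    field_simp
  · filter_upwards [eventually_gt_atTop 0] with t h0
    rw [mul_one_div_cancel h0.ne']

/-! ### Reduction to a planar system -/

namespace IsNonnegSolution

variable {α : ℝ} {c : ℕ → ℝ → ℝ}

theorem continuousOn_Icc (hc : IsNonnegSolution α c) {j : ℕ} (hj : 1 ≤ j) {s t : ℝ} (hs : 0 < s) :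
    ContinuousOn (c j) (Set.Icc s t) :=
  (hc.continuousOn j hj).mono fun _ hu => hs.le.trans hu.1

/-- The concentrations are bounded on compact subintervals of `(0, ∞)`, uniformly in the size. -/
theorem exists_bound (hc : IsNonnegSolution α c) {s t : ℝ} (hs : 0 < s) :
    ∃ M, ∀ j, ∀ u ∈ Set.Icc s t, c (j + 1) u ≤ M := by
  obtain ⟨M₁, hM₁⟩ := (isCompact_Icc.image_of_continuousOn
    (hc.continuousOn_Icc (t := t) le_rfl hs)).bddAbove
  obtain ⟨M₂, hM₂⟩ := (hc.summable s hs).tendsto_atTop_zero.bddAbove_range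
  refine ⟨max M₁ M₂, fun j => ?_⟩
  induction j with
  | zero => exact fun u hu => (hM₁ (Set.mem_image_of_mem _ hu)).trans (le_max_left _ _)
  | succ j ih =>
    intro u hu
    set M := max M₁ M₂
    refine le_of_forall_pos_le_add fun ε hε => ?_
    -- The slope `η` makes the barrier strict: at contact `c (j + 2)` is at least `M`, hence at
    -- least `c (j + 1)`, and its derivative is nonpositive.
    have key : ∀ η > 0, c (j + 1 + 1) u ≤ M + η * (u - s) := by
      intro η hη
      refine image_le_of_deriv_right_lt_deriv_boundary (f := c (j + 1 + 1))
        (f' := fun v => c 1 v * c (j + 1) v - c 1 v * c (j + 1 + 1) v) (a := s) (b := t)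
        (B := fun v => M + η * (v - s)) (B' := fun _ => η)
        (hc.continuousOn_Icc (by omega) hs) ?_ ?_ ?_ ?_ hu
      · exact fun v hv =>
          (hc.deriv_of_two_le (j + 1 + 1) (by omega) v (hs.trans_le hv.1)).hasDerivWithinAt
      · rw [sub_self, mul_zero, add_zero]
        exact (hM₂ (Set.mem_range_self (j + 1))).trans (le_max_right M₁ M₂)
      · intro v
        simpa using (((hasDerivAt_id v).sub_const s).const_mul η).const_add M
      · intro v hv hb
        have h1 := ih v ⟨hv.1, hv.2.le⟩
        have h2 := hc.nonneg 1 le_rfl v (hs.le.trans hv.1)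
        have h3 : 0 ≤ η * (v - s) := mul_nonneg hη.le (by linarith [hv.1])
        rw [hb]
        nlinarith
    have hpos : 0 < u - s + 1 := by linarith [hu.1]
    refine (key (ε / (u - s + 1)) (div_pos hε hpos)).trans ?_
    gcongr
    rw [div_mul_eq_mul_div, div_le_iff₀ hpos]
    nlinarith

theorem hasDerivAt_sum (hc : IsNonnegSolution α c) (n : ℕ) {t : ℝ} (ht : 0 < t) :
    HasDerivAt (fun t => ∑ j ∈ Finset.range n, c (j + 2) t)
      (c 1 t ^ 2 - c 1 t * c (n + 1) t) t := by
  induction n with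
  | zero => simpa [sq] using hasDerivAt_const t (0 : ℝ)
  | succ n ih =>
    simp only [Finset.sum_range_succ]
    refine (ih.add (hc.deriv_of_two_le (n + 2) (by omega) t ht)).congr_deriv ?_
    rw [show n + 2 - 1 = n + 1 from rfl]
    ring

theorem total_sub_eq (hc : IsNonnegSolution α c) {t : ℝ} (ht : 0 < t) :
    totalClusters c t - c 1 t = ∑' j, c (j + 2) t := by
  rw [totalClusters, (hc.summable t ht).tsum_eq_zero_add]
  simp [add_assoc]

theorem tendsto_sum (hc : IsNonnegSolution α c) {t : ℝ} (ht : 0 < t) :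
    Tendsto (fun n => ∑ j ∈ Finset.range n, c (j + 2) t) atTop
      (𝓝 (totalClusters c t - c 1 t)) := by
  rw [hc.total_sub_eq ht]
  exact ((summable_nat_add_iff 1).2 (hc.summable t ht)).hasSum.tendsto_sum_nat

/-- Replaces termwise differentiation of the series: integrate the telescoped partial sums and let
the flux `c 1 * c (n + 1)` vanish by dominated convergence. -/
theorem integral_sq_eq (hc : IsNonnegSolution α c) {s t : ℝ} (hs : 0 < s) (hst : s ≤ t) :
    ∫ u in s..t, c 1 u ^ 2 =
      (totalClusters c t - c 1 t) - (totalClusters c s - c 1 s) := by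
  have hcont : ∀ n, ContinuousOn (fun u => c 1 u ^ 2 - c 1 u * c (n + 1) u) (Set.Icc s t) :=
    fun n => ((hc.continuousOn_Icc le_rfl hs).pow 2).sub
      ((hc.continuousOn_Icc le_rfl hs).mul (hc.continuousOn_Icc (by omega) hs))
  have hftc : ∀ n, ∫ u in s..t, (c 1 u ^ 2 - c 1 u * c (n + 1) u) =
      (∑ j ∈ Finset.range n, c (j + 2) t) - ∑ j ∈ Finset.range n, c (j + 2) s := by
    intro n
    refine intervalIntegral.integral_eq_sub_of_hasDerivAt_of_le hst
      (fun u hu => (hc.hasDerivAt_sum n (hs.trans_le hu.1)).continuousAt.continuousWithinAt)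
      (fun u hu => hc.hasDerivAt_sum n (hs.trans hu.1)) ?_
    exact (hcont n).intervalIntegrable_of_Icc hst
  obtain ⟨M, hM⟩ := hc.exists_bound (t := t) hs
  have hlim : Tendsto (fun n => ∫ u in s..t, (c 1 u ^ 2 - c 1 u * c (n + 1) u)) atTop
      (𝓝 (∫ u in s..t, c 1 u ^ 2)) := by
    refine intervalIntegral.tendsto_integral_filter_of_dominated_convergence
      (fun _ => M ^ 2) ?_ ?_ (by simp) ?_
    · refine Eventually.of_forall fun n => ?_
      rw [Set.uIoc_of_le hst]
      exact ((hcont n).mono Set.Ioc_subset_Icc_self).aestronglyMeasurable measurableSet_Ioc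
    · refine Eventually.of_forall fun n => Eventually.of_forall fun u hu => ?_
      rw [Set.uIoc_of_le hst] at hu
      have hu0 : 0 ≤ u := by linarith [hu.1]
      have h1 := hM 0 u ⟨hu.1.le, hu.2⟩
      have h2 := hM n u ⟨hu.1.le, hu.2⟩
      have h3 := hc.nonneg 1 le_rfl u hu0
      have h4 := hc.nonneg (n + 1) (by omega) u hu0
      simp only [zero_add] at h1
      rw [Real.norm_eq_abs, abs_le]
      constructor <;> nlinarith
    · refine Eventually.of_forall fun u hu => ?_
      rw [Set.uIoc_of_le hst] at hu
      have := ((hc.summable u (hs.trans hu.1)).tendsto_atTop_zero).const_mul (c 1 u)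
      simpa using this.const_sub (c 1 u ^ 2)
  refine tendsto_nhds_unique hlim ?_
  simp only [hftc]
  exact (hc.tendsto_sum (hs.trans_le hst)).sub (hc.tendsto_sum hs)

theorem hasDerivAt_total_sub (hc : IsNonnegSolution α c) {t : ℝ} (ht : 0 < t) :
    HasDerivAt (fun t => totalClusters c t - c 1 t) (c 1 t ^ 2) t := by
  have hs : 0 < t / 2 := half_pos ht
  have hcont : ContinuousOn (fun u => c 1 u ^ 2) (Set.Ioi 0) :=
    ((hc.continuousOn 1 le_rfl).mono Set.Ioi_subset_Ici_self).pow 2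
  have hd : HasDerivAt (fun v => ∫ u in (t / 2)..v, c 1 u ^ 2) (c 1 t ^ 2) t := by
    refine intervalIntegral.integral_hasDerivAt_right ?_ ?_
      (hcont.continuousAt (Ioi_mem_nhds ht))
    · exact (hcont.mono fun u hu => hs.trans_le hu.1).intervalIntegrable_of_Icc (by linarith)
    · exact hcont.stronglyMeasurableAtFilter isOpen_Ioi t ht
  refine (hd.add_const (totalClusters c (t / 2) - c 1 (t / 2))).congr_of_eventuallyEq ?_
  filter_upwards [Ioi_mem_nhds (half_lt_self ht)] with v hv
  rw [hc.integral_sq_eq hs (le_of_lt hv)]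
  ring

theorem hasDerivAt_total (hc : IsNonnegSolution α c) {t : ℝ} (ht : 0 < t) :
    HasDerivAt (totalClusters c) (α - c 1 t * totalClusters c t) t := by
  refine (((hc.hasDerivAt_total_sub ht).add (hc.deriv_one t ht)).congr_deriv ?_).congr_of_eventuallyEq
    (Eventually.of_forall fun u => (sub_add_cancel _ _).symm)
  ring

theorem total_sub_nonneg (hc : IsNonnegSolution α c) {t : ℝ} (ht : 0 < t) :
    0 ≤ totalClusters c t - c 1 t := by
  rw [hc.total_sub_eq ht]
  exact tsum_nonneg fun j => hc.nonneg (j + 2) (by omega) t ht.le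

end IsNonnegSolution

/-- The closed planar system for the monomer density `x` and the density `z` of all larger
clusters. -/
structure IsReducedSolution (α : ℝ) (x z : ℝ → ℝ) : Prop where
  x_nonneg : ∀ t, 0 < t → 0 ≤ x t
  z_nonneg : ∀ t, 0 < t → 0 ≤ z t
  deriv_x : ∀ t, 0 < t → HasDerivAt x (α - 2 * x t ^ 2 - x t * z t) t
  deriv_z : ∀ t, 0 < t → HasDerivAt z (x t ^ 2) t

theorem IsNonnegSolution.isReducedSolution {α : ℝ} {c : ℕ → ℝ → ℝ} (hc : IsNonnegSolution α c) :
    IsReducedSolution α (c 1) (fun t => totalClusters c t - c 1 t) where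
  x_nonneg t ht := hc.nonneg 1 le_rfl t ht.le
  z_nonneg _ ht := hc.total_sub_nonneg ht
  deriv_x t ht := (hc.deriv_one t ht).congr_deriv (by ring)
  deriv_z _ ht := hc.hasDerivAt_total_sub ht

/-! ### Asymptotics of the planar system -/

namespace IsReducedSolution

variable {α : ℝ} {x z : ℝ → ℝ}

theorem eventually_x_le (h : IsReducedSolution α x z) (hα : 0 < α) :
    ∀ᶠ t in atTop, x t ≤ 1 + α := by
  refine eventually_le_of_deriv_le_neg one_pos
    ((eventually_gt_atTop 0).mono fun t ht => h.deriv_x t ht) ?_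
  filter_upwards [eventually_gt_atTop 0] with t ht hb
  have h1 := mul_nonneg (h.x_nonneg t ht) (h.z_nonneg t ht)
  nlinarith

theorem tendsto_z (h : IsReducedSolution α x z) (hα : 0 < α) : Tendsto z atTop atTop := by
  have hmono : MonotoneOn z (Set.Ioi 0) := by
    refine monotoneOn_of_deriv_nonneg (convex_Ioi 0)
      (fun t ht => (h.deriv_z t ht).continuousAt.continuousWithinAt) ?_ ?_
    · intro t ht
      rw [interior_Ioi] at ht
      exact (h.deriv_z t ht).differentiableAt.differentiableWithinAt
    · intro t ht
      rw [interior_Ioi] at ht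
      rw [(h.deriv_z t ht).deriv]
      positivity
  suffices hub : ∀ K, 0 ≤ K → ∃ t, 0 < t ∧ K ≤ z t by
    refine tendsto_atTop.2 fun K => ?_
    obtain ⟨t₀, ht₀, hK⟩ := hub (max K 0) (le_max_right _ _)
    filter_upwards [eventually_ge_atTop t₀] with t ht
    exact (le_max_left _ _).trans (hK.trans (hmono ht₀ (ht₀.trans_le ht) ht))
  intro K hK
  by_contra! hlt
  -- If `z < K` throughout, then `x ≤ δ` gives `2x² + xz ≤ δ(2 + K) ≤ α/2`, so `x' ≥ α/2`. Thus
  -- eventually `x ≥ δ`, `z' ≥ δ²`, and `z` reaches `K`.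
  set δ := min 1 (α / (2 * (2 + K))) with hδ
  have hδ0 : 0 < δ := lt_min one_pos (by positivity)
  have hδ1 : δ ≤ 1 := min_le_left _ _
  have hδ2 : δ * (2 + K) ≤ α / 2 := by
    have := min_le_right 1 (α / (2 * (2 + K)))
    rw [← hδ, le_div_iff₀ (by positivity)] at this
    linarith
  have hx : ∀ᶠ t in atTop, -x t ≤ -δ := by
    refine eventually_le_of_deriv_le_neg (half_pos hα)
      ((eventually_gt_atTop 0).mono fun t ht => (h.deriv_x t ht).neg) ?_
    filter_upwards [eventually_gt_atTop 0] with t ht hb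
    have h1 := h.x_nonneg t ht
    have h2 : x t ≤ δ := by linarith
    have h3 : x t * z t ≤ δ * K :=
      mul_le_mul h2 (hlt t ht).le (h.z_nonneg t ht) hδ0.le
    nlinarith
  have hz : ∀ᶠ t in atTop, -z t ≤ -K := by
    refine eventually_le_of_deriv_le_neg (pow_pos hδ0 2)
      ((eventually_gt_atTop 0).mono fun t ht => (h.deriv_z t ht).neg) ?_
    filter_upwards [hx] with t ht _
    have : δ ^ 2 ≤ x t ^ 2 := pow_le_pow_left₀ hδ0.le (by linarith) 2
    linarith
  obtain ⟨t, ht, ht0⟩ := (hz.and (eventually_gt_atTop 0)).exists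
  have := hlt t ht0
  linarith

theorem eventually_one_le_mul_z (h : IsReducedSolution α x z) (hα : 0 < α) :
    ∀ᶠ t in atTop, 1 ≤ t * z t := by
  filter_upwards [(h.tendsto_z hα).eventually_ge_atTop 1, eventually_ge_atTop 1] with t h1 h2
  nlinarith

theorem tendsto_x (h : IsReducedSolution α x z) (hα : 0 < α) : Tendsto x atTop (𝓝 0) := by
  refine tendsto_of_relaxation (A := z) (g := fun t => (α - 2 * x t ^ 2) / z t) ?_
    (h.eventually_one_le_mul_z hα) ?_
  · filter_upwards [(h.tendsto_z hα).eventually_gt_atTop 0, eventually_gt_atTop 0] with t hz ht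
    refine (h.deriv_x t ht).congr_deriv ?_
    field_simp
  · have hb : ∀ᶠ t in atTop, ‖(α - 2 * x t ^ 2) / z t‖ ≤ (α + 2 * (1 + α) ^ 2) / z t := by
      filter_upwards [(h.tendsto_z hα).eventually_gt_atTop 0, eventually_gt_atTop 0,
        h.eventually_x_le hα] with t hz ht hx
      rw [norm_div, Real.norm_of_nonneg hz.le]
      gcongr
      have h1 : x t ^ 2 ≤ (1 + α) ^ 2 := pow_le_pow_left₀ (h.x_nonneg t ht) hx 2
      have h2 := sq_nonneg (x t)
      rw [Real.norm_eq_abs, abs_le]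
      constructor <;> linarith
    exact squeeze_zero_norm' hb ((h.tendsto_z hα).const_div_atTop _)

theorem tendsto_x_mul_z (h : IsReducedSolution α x z) (hα : 0 < α) :
    Tendsto (fun t => x t * z t) atTop (𝓝 α) := by
  have hx := h.tendsto_x hα
  refine tendsto_of_relaxation (A := z)
    (g := fun t => α - 2 * x t ^ 2 + x t ^ 3 * (z t)⁻¹) ?_ (h.eventually_one_le_mul_z hα) ?_
  · filter_upwards [(h.tendsto_z hα).eventually_gt_atTop 0, eventually_gt_atTop 0] with t hz ht
    refine ((h.deriv_x t ht).mul (h.deriv_z t ht)).congr_deriv ?_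
    field_simp
    ring
  · simpa using (((hx.pow 2).const_mul 2).const_sub α).add
      ((hx.pow 3).mul (h.tendsto_z hα).inv_tendsto_atTop)

theorem tendsto_z_pow_div (h : IsReducedSolution α x z) (hα : 0 < α) :
    Tendsto (fun t => z t ^ 3 / t) atTop (𝓝 (3 * α ^ 2)) := by
  refine tendsto_div_id_of_tendsto_deriv (u' := fun t => 3 * (x t * z t) ^ 2) ?_
    (((h.tendsto_x_mul_z hα).pow 2).const_mul 3)
  filter_upwards [eventually_gt_atTop 0] with t ht
  refine ((h.deriv_z t ht).pow 3).congr_deriv ?_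
  norm_num
  ring

theorem tendsto_rpow_mul_z (h : IsReducedSolution α x z) (hα : 0 < α) :
    Tendsto (fun t => (3 * α ^ 2 * t) ^ (-(1 / 3) : ℝ) * z t) atTop (𝓝 1) := by
  have h1 : Tendsto (fun t => (z t ^ 3 / t / (3 * α ^ 2)) ^ (1 / 3 : ℝ)) atTop (𝓝 1) := by
    have := ((h.tendsto_z_pow_div hα).div_const (3 * α ^ 2)).rpow_const (p := (1 / 3 : ℝ))
      (Or.inr (by norm_num))
    rwa [div_self (by positivity), Real.one_rpow] at this
  refine h1.congr' ?_
  filter_upwards [eventually_gt_atTop 0] with t ht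
  have hz := h.z_nonneg t ht
  rw [div_div, mul_comm t, Real.div_rpow (by positivity) (by positivity),
    Real.rpow_neg (by positivity), ← Real.rpow_natCast, ← Real.rpow_mul hz]
  norm_num
  rw [div_eq_inv_mul]

theorem rpow_eq (hα : 0 < α) {t : ℝ} (ht : 0 < t) :
    (3 * t / α) ^ (1 / 3 : ℝ) = (α * (3 * α ^ 2 * t) ^ (-(1 / 3) : ℝ))⁻¹ := by
  have h1 : 3 * t / α = 3 * α ^ 2 * t / α ^ 3 := by
    field_simp
  rw [h1, Real.div_rpow (by positivity) (by positivity), Real.rpow_neg (by positivity),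
    ← Real.rpow_natCast α 3, ← Real.rpow_mul hα.le]
  norm_num
  rw [div_eq_mul_inv]

theorem tendsto_rpow_mul_x (h : IsReducedSolution α x z) (hα : 0 < α) :
    Tendsto (fun t => (3 * t / α) ^ (1 / 3 : ℝ) * x t) atTop (𝓝 1) := by
  have h1 := (h.tendsto_x_mul_z hα).div ((h.tendsto_rpow_mul_z hα).const_mul α)
    (by simpa using hα.ne')
  rw [mul_one, div_self hα.ne'] at h1
  refine h1.congr' ?_
  filter_upwards [eventually_gt_atTop 0, (h.tendsto_z hα).eventually_gt_atTop 0] with t ht hz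
  have : 0 < (3 * α ^ 2 * t) ^ (-(1 / 3) : ℝ) := by positivity
  simp only [Pi.div_apply]
  rw [rpow_eq hα ht]
  field_simp

/-- The relaxation rate `x` of each larger size dominates the `1/t` produced by differentiating
power weights. -/
theorem tendsto_mul_x (h : IsReducedSolution α x z) (hα : 0 < α) :
    Tendsto (fun t => t * x t) atTop atTop := by
  have h1 : Tendsto (fun t : ℝ => t * (3 * t / α) ^ (-(1 / 3) : ℝ)) atTop atTop := by
    have h2 : Tendsto (fun t : ℝ => (3 / α) ^ (-(1 / 3) : ℝ) * t ^ (2 / 3 : ℝ)) atTop atTop :=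
      (tendsto_rpow_atTop (by norm_num)).const_mul_atTop (by positivity)
    refine h2.congr' ?_
    filter_upwards [eventually_gt_atTop 0] with t ht
    rw [mul_div_right_comm, Real.mul_rpow (by positivity) ht.le, mul_left_comm,
      ← Real.rpow_one_add' ht.le (by norm_num)]
    norm_num
  refine (h1.atTop_mul_pos one_pos (h.tendsto_rpow_mul_x hα)).congr' ?_
  filter_upwards [eventually_gt_atTop 0] with t ht
  have : 0 < (3 * t / α) ^ (1 / 3 : ℝ) := by positivity
  rw [Real.rpow_neg (by positivity)]
  field_simp

end IsReducedSolution

/-! ### Back to the cluster system -/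

theorem hasDerivAt_mul_div_rpow {α p t : ℝ} (hα : 0 < α) (ht : 0 < t) :
    HasDerivAt (fun t => (3 * t / α) ^ p) (p / t * (3 * t / α) ^ p) t := by
  have h1 : HasDerivAt (fun t : ℝ => 3 * t / α) (3 * 1 / α) t :=
    ((hasDerivAt_id t).const_mul 3).div_const α
  refine (h1.rpow_const (p := p) (Or.inl (by positivity))).congr_deriv ?_
  rw [Real.rpow_sub_one (by positivity)]
  field_simp

namespace IsNonnegSolution

variable {α : ℝ} {c : ℕ → ℝ → ℝ}

theorem tendsto_rpow_mul (hc : IsNonnegSolution α c) (hα : 0 < α) {j : ℕ} (hj : 1 ≤ j) :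
    Tendsto (fun t => (3 * t / α) ^ (1 / 3 : ℝ) * c j t) atTop (𝓝 1) := by
  have hr := hc.isReducedSolution
  induction j, hj using Nat.le_induction with
  | base => exact hr.tendsto_rpow_mul_x hα
  | succ j hj ih =>
    -- The weight contributes `1/(3t)` to the rate, so `4/3` leaves `tA ≥ 4/3 - 1/3 = 1`.
    have hbig := (hr.tendsto_mul_x hα).eventually_ge_atTop (4 / 3)
    refine tendsto_of_relaxation (A := fun t => c 1 t - 1 / 3 / t)
      (g := fun t => (3 * t / α) ^ (1 / 3 : ℝ) * c j t * (1 - 1 / 3 * (t * c 1 t)⁻¹)⁻¹) ?_ ?_ ?_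
    · filter_upwards [hbig, eventually_gt_atTop 0] with t hx ht
      refine ((hasDerivAt_mul_div_rpow hα ht).mul
        (hc.deriv_of_two_le (j + 1) (by omega) t ht)).congr_deriv ?_
      have hc1 : 0 < c 1 t := pos_of_mul_pos_right (by linarith) ht.le
      have h1 : (t * c 1 t)⁻¹ ≤ 1 := inv_le_one_of_one_le₀ (by linarith)
      have h2 : (c 1 t - 1 / 3 / t) * (1 - 1 / 3 * (t * c 1 t)⁻¹)⁻¹ = c 1 t := by
        rw [mul_inv_eq_iff_eq_mul₀ (by linarith)]
        field_simp
      rw [Nat.add_sub_cancel, mul_sub _ _ ((3 * t / α) ^ (1 / 3 : ℝ) * c (j + 1) t),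
        mul_left_comm, h2]
      ring
    · filter_upwards [hbig, eventually_gt_atTop 0] with t hx ht
      rw [mul_sub, mul_div_cancel₀ _ ht.ne']
      linarith
    · have h1 := (((hr.tendsto_mul_x hα).inv_tendsto_atTop.const_mul (1 / 3)).const_sub 1).inv₀
        (by norm_num)
      simpa using ih.mul h1

theorem tendsto_rpow_mul_total (hc : IsNonnegSolution α c) (hα : 0 < α) :
    Tendsto (fun t => (3 * α ^ 2 * t) ^ (-(1 / 3) : ℝ) * totalClusters c t) atTop (𝓝 1) := by
  have hr := hc.isReducedSolution
  have h1 : Tendsto (fun t : ℝ => (3 * α ^ 2 * t) ^ (-(1 / 3) : ℝ)) atTop (𝓝 0) :=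
    (tendsto_rpow_neg_atTop (by norm_num)).comp
      (tendsto_id.const_mul_atTop (by positivity))
  have h2 := (hr.tendsto_rpow_mul_z hα).add (h1.mul (hr.tendsto_x hα))
  rw [mul_zero, add_zero] at h2
  exact h2.congr fun t => by ring

/-- With `N` the total and `D = α - c₁N`, one has `N' = D` and `c₁' = D - c₁²`, so `D' = c₁²N - (c₁
+ N)D`. Thus `D` relaxes towards `c₁²N/(c₁ + N) ~ c₁²`. -/
theorem tendsto_rpow_mul_sub (hc : IsNonnegSolution α c) (hα : 0 < α) :
    Tendsto (fun t => (3 * t / α) ^ (2 / 3 : ℝ) * (α - c 1 t * totalClusters c t))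
      atTop (𝓝 1) := by
  have hr := hc.isReducedSolution
  have hx := hr.tendsto_x hα
  have hy : Tendsto (totalClusters c) atTop atTop := by
    simpa using (hr.tendsto_z hα).atTop_add hx
  have hA : ∀ᶠ t in atTop, 1 ≤ t * (c 1 t + totalClusters c t - 2 / 3 / t) := by
    filter_upwards [hy.eventually_ge_atTop (5 / 3), eventually_ge_atTop 1] with t h1 ht
    have h2 := hc.nonneg 1 le_rfl t (by linarith)
    rw [mul_sub, mul_div_cancel₀ _ (by linarith)]
    nlinarith
  refine tendsto_of_relaxation (A := fun t => c 1 t + totalClusters c t - 2 / 3 / t)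
    (g := fun t => ((3 * t / α) ^ (1 / 3 : ℝ) * c 1 t) ^ 2 *
      ((c 1 t - 2 / 3 / t) * (totalClusters c t)⁻¹ + 1)⁻¹) ?_ hA ?_
  · filter_upwards [hA, hy.eventually_gt_atTop 0, eventually_gt_atTop 0] with t hAt hyt ht
    have hsq : (3 * t / α) ^ (2 / 3 : ℝ) = ((3 * t / α) ^ (1 / 3 : ℝ)) ^ 2 := by
      rw [← Real.rpow_natCast, ← Real.rpow_mul (by positivity)]
      norm_num
    refine ((hasDerivAt_mul_div_rpow hα ht).mul
      (((hc.deriv_one t ht).mul (hc.hasDerivAt_total ht)).const_sub α)).congr_deriv ?_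
    have hA0 : 0 < c 1 t + totalClusters c t - 2 / 3 / t :=
      pos_of_mul_pos_right (by linarith) ht.le
    have h2 : (c 1 t + totalClusters c t - 2 / 3 / t) *
        ((c 1 t - 2 / 3 / t) * (totalClusters c t)⁻¹ + 1)⁻¹ = totalClusters c t := by
      rw [mul_inv_eq_iff_eq_mul₀]
      · field_simp
        ring
      · rw [← mul_ne_zero_iff_right hyt.ne']
        convert hA0.ne' using 1
        field_simp
        ring
    rw [mul_sub _ _ ((3 * t / α) ^ (2 / 3 : ℝ) * (α - c 1 t * totalClusters c t)),
      mul_left_comm, h2, mul_pow, ← hsq]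
    simp only [Pi.mul_apply]
    ring
  · have h1 : Tendsto (fun t : ℝ => c 1 t - 2 / 3 / t) atTop (𝓝 0) := by
      simpa using hx.sub (tendsto_id.const_div_atTop (2 / 3 : ℝ))
    have h2 := ((h1.mul hy.inv_tendsto_atTop).add_const 1).inv₀ (by norm_num)
    simpa using ((hr.tendsto_rpow_mul_x hα).pow 2).mul h2

end IsNonnegSolution

theorem theorem2 (α : ℝ) (hα : 0 < α) (c : ℕ → ℝ → ℝ) (hc : IsNonnegSolution α c)
    (h0 : Summable (fun j : ℕ => c (j + 1) 0)) :
    (∀ j : ℕ, 1 ≤ j →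
      Tendsto (fun t : ℝ => (3 * t / α) ^ (1 / 3 : ℝ) * c j t) atTop (𝓝 1)) ∧
    Tendsto (fun t : ℝ => (3 * α ^ 2 * t) ^ (-(1 / 3) : ℝ) * totalClusters c t) atTop (𝓝 1) ∧
    Tendsto (fun t : ℝ => (3 * t / α) ^ (2 / 3 : ℝ) * (α - c 1 t * totalClusters c t))
      atTop (𝓝 1) := by
  exact ⟨fun _ hj => hc.tendsto_rpow_mul hα hj, hc.tendsto_rpow_mul_total hα,
    hc.tendsto_rpow_mul_sub hα⟩
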